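/- Let $(X,d)$ be a metric space with a Borel regular measure $\mu$ such that $0<\mu(B)<\infty$ for every ball $B$ and which is doubling: $\mu(2B)\le c\,\mu(B)$ for all balls $B$. A ball $B=B(x_B,r_B)$ is open and comes with a center $x_B$ and a radius $0<r_B<\infty$, and $\sigma B:=B(x_B,\sigma r_B)$. Let $c_\mu$ and $D>0$ be constants, associated with $\mu$, such that $$\frac{\mu(B')}{\mu(B)}\le c_\mu\Big(\frac{r_{B'}}{r_B}\Big)^D\qquad\text{for all balls } B\subset B' \text{ with } r_B\le r_{B'}$$ (such constants exist because $\mu$ is doubling). For a ball $B$ write $F_B=\frac1{\mu(B)}\int_B F\,d\mu$ for the average, and let $\|f\|_{L^p,B}$ and $\|f\|_{L^{p,\infty},B}=\sup_{t>0}t\,\big(\mu(\{x\in B:|f(x)|>t\})/\mu(B)\big)^{1/p}$ be the strong and weak $L^p$ norms on $B$ with respect to the normalized measure $\mu|_B/\mu(B)$. Let $\eta>0$ and $\tau\ge1$. For a ball $B_0$ put $\widehat B_0=(1+\eta)B_0$ and $\mathcal B=\mathcal B_{B_0}=\{B(x_B,r_B): x_B\in B_0,\ 0<r_B\le\eta\,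 r_{B_0}\}$, and define $$M_{\mathcal B}f(x)=\sup_{x\in B\in\mathcal B}\frac1{\mu(B)}\int_B|f|\,d\mu ,$$ with $M_{\mathcal B}f(x)=0$ if no ball of $\mathcal B$ contains $x$. Let $\Theta\ge1$, $0\le\delta<\frac12$, let $F\ge0$ be a function with $F\in L^1(\widehat B_0)$ (outside $\widehat B_0$ the non-negative values of $F$ are arbitrary, for instance $0$), and assume that for every $B\in\mathcal B$ there are non-negative measurable functions $H^B,G^B$ on $B$ and a constant $g^B\ge0$ with (i) $F(x)\le G^B(x)+H^B(x)$ for $\mu$-a.e. $x\in B$; (ii) $\|H^B\|_{L^\infty(B)}\le\Theta\,F_{\tau B}$; (iii) $\frac1{\mu(B)}\int_B G^B\,d\mu\le\delta\,F_{\tau B}+g^B$. Put $G^*_{\mathcal B}(x)=\sup_{x\in B\in\mathcal B}g^B$, with $G^*_{\mathcal B}(x)=0$ if no ball of $\mathcal B$ contains $x$. Then there is a constant $C_\mu\ge1$ depending only on $\mu$ such that the following hold. (a) There is $\lambda_0=\lambda_0(\tau,\eta,\mu)>0$ such that, whenever $\lambda\ge\lambda_0F_{\widehat B_0}$, $K>\max\{\Theta,c_\mu3^D\}$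 and $0<\gamma<1$, $$\mu\big(\{x\in\widehat B_0:M_{\mathcal B}F(x)>K\lambda,\ G^*_{\mathcal B}(x)\le\gamma\lambda\}\big)\le C_\mu\,\frac{\delta+\gamma}{K-\Theta}\,\mu\big(\{x\in\widehat B_0:M_{\mathcal B}F(x)>\lambda\}\big).$$ (b) If $0\le\delta<\frac1{2C_\mu}\min\big\{1,\frac{\Theta}{c_\mu3^D}\big\}$ and $1<p<\frac{\log(1/(C_\mu\delta\Theta^{-1}))}{\log(2\max\{\Theta,c_\mu3^D\})}$ (any $1<p<\infty$ if $\delta=0$), then there is a finite constant $C$ depending only on $p,\Theta,\delta,\tau,\eta$ and $\mu$ (not on $B_0$, $F$, $G^B$, $H^B$, $g^B$) such that $$\|F\|_{L^{p,\infty},B_0}\le C\,\|M_{\mathcal B}F\|_{L^{p,\infty},\widehat B_0},\qquad \|M_{\mathcal B}F\|_{L^{p,\infty},\widehat B_0}\le C\big(\|G^*_{\mathcal B}\|_{L^{p,\infty},\widehat B_0}+F_{\widehat B_0}\big),$$ $$\|F\|_{L^p,B_0}\le\Big(\frac{\mu(\widehat B_0)}{\mu(B_0)}\Big)^{1/p}\|M_{\mathcal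 B}F\|_{L^p,\widehat B_0},\qquad \|M_{\mathcal B}F\|_{L^p,\widehat B_0}\le C\big(\|G^*_{\mathcal B}\|_{L^p,\widehat B_0}+F_{\widehat B_0}\big).$$ -/

import Mathlib

open MeasureTheory Metric Set
open scoped ENNReal NNReal ProbabilityTheory

noncomputable section

namespace GoodLambda

variable {X : Type*} [MetricSpace X] [MeasurableSpace X]

/-- All balls have positive finite measure, and `μ(2B) ≤ c μ(B)` for all balls `B`. -/
structure IsDoubling (μ : Measure X) : Prop where
  pos : ∀ (x : X) (r : ℝ), 0 < r → 0 < μ (ball x r)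
  finite : ∀ (x : X) (r : ℝ), 0 < r → μ (ball x r) < ∞
  doubling : ∃ c : ℝ≥0, ∀ (x : X) (r : ℝ), 0 < r → μ (ball x (2 * r)) ≤ c * μ (ball x r)

/-- `μ(B') / μ(B) ≤ c (r_{B'} / r_B) ^ D` for all balls `B ⊆ B'` with `r_B ≤ r_{B'}`. -/
def HasDoublingConstants (μ : Measure X) (c D : ℝ) : Prop :=
  ∀ (x y : X) (r s : ℝ), 0 < r → r ≤ s → ball x r ⊆ ball y s →
    (μ (ball y s)).toReal / (μ (ball x r)).toReal ≤ c * (s / r) ^ D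

/-- The family of balls centered in `B₀ = ball x₀ r₀` with radius at most `η r₀`.
A ball comes with a center and a radius, so it is recorded as the pair `(center, radius)`. -/
def basis (x₀ : X) (r₀ η : ℝ) : Set (X × ℝ) :=
  {b | b.1 ∈ ball x₀ r₀ ∧ 0 < b.2 ∧ b.2 ≤ η * r₀}

/-- The maximal operator of a family `𝓑` of balls; it is `0` at points in no ball of `𝓑`. -/
def maximal (μ : Measure X) (𝓑 : Set (X × ℝ)) (f : X → ℝ≥0∞) (x : X) : ℝ≥0∞ :=
  ⨆ b ∈ 𝓑, ⨆ _ : x ∈ ball b.1 b.2, ⨍⁻ y in ball b.1 b.2, f y ∂μ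

/-- `G*(x) = sup {g^B : x ∈ B ∈ 𝓑}`; it is `0` at points in no ball of `𝓑`. -/
def gStar (𝓑 : Set (X × ℝ)) (g : X × ℝ → ℝ≥0) (x : X) : ℝ≥0∞ :=
  ⨆ b ∈ 𝓑, ⨆ _ : x ∈ ball b.1 b.2, (g b : ℝ≥0∞)

/-- The `L^p` norm on `B` with respect to the normalized measure `μ|_B / μ(B)`. -/
def strongNorm (μ : Measure X) (p : ℝ) (B : Set X) (f : X → ℝ≥0∞) : ℝ≥0∞ :=
  eLpNorm f (ENNReal.ofReal p) (μ[|B])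

/-- The weak `L^p` norm `sup_{t > 0} t ν({f > t}) ^ (1/p)` on `B`, where `ν` is the normalized
measure `μ|_B / μ(B)`. -/
def weakNorm (μ : Measure X) (p : ℝ) (B : Set X) (f : X → ℝ≥0∞) : ℝ≥0∞ :=
  ⨆ t : ℝ≥0, (t : ℝ≥0∞) * (μ[|B]) {x | (t : ℝ≥0∞) < f x} ^ (1 / p)

/-- `0 ≤ F ∈ L¹((1 + η)B₀)`, and for every ball `B` of the basis the non-negative functions
`H b`, `G b` and the constant `g b ≥ 0` satisfy the three hypotheses. Values of `F` outside
`(1 + η)B₀` are arbitrary; in particular `F` may be extended by `0`. -/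
structure Admissible (μ : Measure X) (x₀ : X) (r₀ η τ Θ δ : ℝ) (F : X → ℝ≥0∞)
    (G H : X × ℝ → X → ℝ≥0∞) (g : X × ℝ → ℝ≥0) : Prop where
  integrable : IntegrableOn F (ball x₀ ((1 + η) * r₀)) μ
  measurable_G : ∀ b ∈ basis x₀ r₀ η, AEMeasurable (G b) (μ.restrict (ball b.1 b.2))
  measurable_H : ∀ b ∈ basis x₀ r₀ η, AEMeasurable (H b) (μ.restrict (ball b.1 b.2))
  le_add : ∀ b ∈ basis x₀ r₀ η,
    ∀ᵐ x ∂(μ.restrict (ball b.1 b.2)), F x ≤ G b x + H b x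
  norm_H : ∀ b ∈ basis x₀ r₀ η,
    eLpNorm (H b) ∞ (μ.restrict (ball b.1 b.2))
      ≤ ENNReal.ofReal Θ * ⨍⁻ x in ball b.1 (τ * b.2), F x ∂μ
  average_G : ∀ b ∈ basis x₀ r₀ η,
    ⨍⁻ x in ball b.1 b.2, G b x ∂μ
      ≤ ENNReal.ofReal δ * (⨍⁻ x in ball b.1 (τ * b.2), F x ∂μ) + g b

end GoodLambda

end

namespace GoodLambda

open Filter Topology

/-! The good-lambda inequality is a stopping argument carried out with balls. At a level `λ` above a
multiple of the average of `F` over the enlarged ball, every ball of the basis with average above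
`λ` is small. Among these balls take those whose radius is nearly maximal at one of their points,
and select a disjoint subfamily by Vitali. For a selected `b`, near maximality forces the average of
`F` over the `13τ`-dilate of `b` to be at most `λ`. Hence `H ≤ Θλ` on the dilate `13b`, and a ball
inside `13b` on which `F` averages more than `Kλ` must carry a `G`-average of at least `(K - Θ)λ`.
The weak type `(1, 1)` inequality (`mul_measure_le_lintegral`), applied to the function `G` of
`13b`, bounds the bad set near `b` by a multiple of `(δ + γ)/(K - Θ) μ(b)`; summing over the
disjoint `b` gives `Admissible.measure_goodLambda_le`.

For the norms, use the inequality at level `t/K` with `K = 2 max {Θ, c_μ 3^D}`. The bound on `p` is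
exactly what allows a `γ` with `q K^p < 1`, where `q` is the good-lambda factor (`exists_gamma`).
The term with the maximal function on the right is then absorbed into the left, after truncation to
make it finite. Lebesgue differentiation (`ae_le_maximal`) passes from the maximal function back to
`F`. -/

/-- Basic covering lemma for a family of balls, recorded as pairs of a center and a radius. -/
theorem exists_disjoint_balls {X : Type*} [MetricSpace X] (T : Set (X × ℝ)) (R : ℝ)
    (hT : ∀ b ∈ T, 0 < b.2)
    (hR : ∀ b ∈ T, b.2 ≤ R) [SecondCountableTopology X] :
    ∃ u ⊆ T, u.Countable ∧ u.PairwiseDisjoint (fun b => ball b.1 b.2) ∧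
      ∀ a ∈ T, ∃ b ∈ u, a.2 ≤ 2 * b.2 ∧ ball a.1 a.2 ⊆ ball b.1 (5 * b.2) := by
  obtain ⟨u, huT, hu, hcov⟩ := Vitali.exists_disjoint_subfamily_covering_enlargement
    (fun b : X × ℝ => ball b.1 b.2) T (fun b => b.2) 2 one_lt_two (fun b hb => (hT b hb).le) R
    hR (fun b hb => nonempty_ball.2 (hT b hb))
  refine ⟨u, huT, hu.countable_of_isOpen (fun _ _ => isOpen_ball)
    (fun b hb => nonempty_ball.2 (hT b (huT hb))), hu, fun a ha => ?_⟩
  obtain ⟨b, hb, ⟨z, hza, hzb⟩, hab⟩ := hcov a ha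
  refine ⟨b, hb, hab, fun y hy => ?_⟩
  simp only [mem_ball] at *
  -- The points of `a` lie within `2 r_a + r_b ≤ 5 r_b` of the center of `b`.
  linarith [dist_triangle y a.1 b.1, dist_triangle_left a.1 b.1 z]

/-! ### Consequences of doubling and the weak type inequality -/

section Basic

variable {X : Type*} [MetricSpace X] [MeasurableSpace X] {μ : Measure X} {c D : ℝ}

theorem IsDoubling.ne_top (hμ : IsDoubling μ) (x : X) (r : ℝ) : μ (ball x r) ≠ ∞ := by
  rcases le_or_gt r 0 with hr | hr
  · simp [ball_eq_empty.2 hr]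
  · exact (hμ.finite x r hr).ne

theorem HasDoublingConstants.one_le (hcD : HasDoublingConstants μ c D) (hμ : IsDoubling μ)
    (x : X) : 1 ≤ c := by
  have h := hcD x x 1 1 one_pos le_rfl subset_rfl
  have h1 : 0 < (μ (ball x 1)).toReal :=
    ENNReal.toReal_pos (hμ.pos x 1 one_pos).ne' (hμ.ne_top x 1)
  rwa [div_self h1.ne', div_one, Real.one_rpow, mul_one] at h

theorem HasDoublingConstants.measure_le (hcD : HasDoublingConstants μ c D) (hμ : IsDoubling μ)
    {x y : X} {r s : ℝ} (hr : 0 < r) (hrs : r ≤ s) (h : ball x r ⊆ ball y s) :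
    μ (ball y s) ≤ ENNReal.ofReal (c * (s / r) ^ D) * μ (ball x r) := by
  have h0 : 0 < (μ (ball x r)).toReal :=
    ENNReal.toReal_pos (hμ.pos x r hr).ne' (hμ.ne_top x r)
  have h1 := (div_le_iff₀ h0).1 (hcD x y r s hr hrs h)
  rw [← ENNReal.ofReal_toReal (hμ.ne_top y s), ← ENNReal.ofReal_toReal (hμ.ne_top x r),
    ← ENNReal.ofReal_mul' h0.le]
  exact ENNReal.ofReal_le_ofReal h1

theorem HasDoublingConstants.measure_mul_le (hcD : HasDoublingConstants μ c D)
    (hμ : IsDoubling μ) (x : X) {r k : ℝ} (hr : 0 < r) (hk : 1 ≤ k) :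
    μ (ball x (k * r)) ≤ ENNReal.ofReal (c * k ^ D) * μ (ball x r) := by
  have h : r ≤ k * r := by nlinarith
  have := hcD.measure_le hμ hr h (ball_subset_ball (x := x) h)
  rwa [mul_div_assoc, div_self hr.ne', mul_one] at this

theorem IsDoubling.isLocallyFiniteMeasure (hμ : IsDoubling μ) : IsLocallyFiniteMeasure μ :=
  ⟨fun x => ⟨ball x 1, ball_mem_nhds x one_pos, hμ.finite x 1 one_pos⟩⟩

theorem IsDoubling.isUnifLocDoublingMeasure (hμ : IsDoubling μ) :
    IsUnifLocDoublingMeasure μ := by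
  obtain ⟨c, hc⟩ := hμ.doubling
  refine ⟨⟨c * c, ?_⟩⟩
  filter_upwards [self_mem_nhdsWithin] with ε hε x
  have hε : 0 < ε := hε
  calc μ (closedBall x (2 * ε)) ≤ μ (ball x (2 * (2 * ε))) :=
        measure_mono (closedBall_subset_ball (by linarith))
    _ ≤ c * (c * μ (ball x ε)) := (hc x _ (by linarith)).trans (by gcongr; exact hc x ε hε)
    _ ≤ (c * c : ℝ≥0) * μ (closedBall x ε) := by
        rw [ENNReal.coe_mul, mul_assoc]; gcongr; exact ball_subset_closedBall

variable [BorelSpace X]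

/-- A disjoint family of balls of positive measure is countable in a σ-finite space, so maximal
disjoint families of balls of radius `ε / 2` have countable sets of centers, and these are
`ε`-dense. -/
theorem IsDoubling.secondCountableTopology (hμ : IsDoubling μ) : SecondCountableTopology X := by
  rcases isEmpty_or_nonempty X with hX | ⟨⟨x₀⟩⟩
  · infer_instance
  have : SigmaFinite μ := ⟨⟨{
    set := fun n : ℕ => ball x₀ n
    set_mem := fun _ => trivial
    finite := fun n => (hμ.ne_top x₀ n).lt_top
    spanning := iUnion_ball_nat x₀ }⟩⟩
  refine Metric.secondCountable_of_almost_dense_set fun ε hε => ?_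
  -- With a constant size function the covering theorem reduces to the existence of a maximal
  -- disjoint subfamily.
  obtain ⟨u, -, hu, hcov⟩ := Vitali.exists_disjoint_subfamily_covering_enlargement
    (fun x : X => ball x (ε / 2)) univ (fun _ => 1) 2 one_lt_two (fun _ _ => zero_le_one) 1
    (fun _ _ => le_rfl) (fun x _ => nonempty_ball.2 (half_pos hε))
  refine ⟨u, ?_, fun x => ?_⟩
  · have h := Measure.countable_meas_pos_of_disjoint_iUnion (μ := μ)
      (As := fun x : u => ball (x : X) (ε / 2)) (fun _ => isOpen_ball.measurableSet)
      (fun x y hxy => hu x.2 y.2 (fun h => hxy (Subtype.ext h)))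
    have h' : {x : u | 0 < μ (ball (x : X) (ε / 2))} = univ :=
      eq_univ_of_forall fun x => hμ.pos _ _ (half_pos hε)
    rw [h'] at h
    exact countable_coe_iff.1 (countable_univ_iff.1 h)
  · obtain ⟨y, hy, ⟨z, hzx, hzy⟩, -⟩ := hcov x (mem_univ x)
    refine ⟨y, hy, ?_⟩
    rw [mem_ball] at hzx hzy
    linarith [dist_triangle_left x y z]

/-- Weak type `(1, 1)` inequality for a maximal operator over balls contained in `W`. -/
theorem mul_measure_le_lintegral [SecondCountableTopology X] (hμ : IsDoubling μ)
    (hcD : HasDoublingConstants μ c D) {S W : Set X} {R : ℝ} {f : X → ℝ≥0∞} {s : ℝ≥0∞}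
    (h : ∀ y ∈ S, ∃ b : X × ℝ, 0 < b.2 ∧ b.2 ≤ R ∧ y ∈ ball b.1 b.2 ∧ ball b.1 b.2 ⊆ W ∧
      s ≤ ⨍⁻ x in ball b.1 b.2, f x ∂μ) :
    s * μ S ≤ ENNReal.ofReal (c * 5 ^ D) * ∫⁻ x in W, f x ∂μ := by
  obtain ⟨u, huT, huc, hu, hcov⟩ := exists_disjoint_balls
    {b : X × ℝ | 0 < b.2 ∧ b.2 ≤ R ∧ ball b.1 b.2 ⊆ W ∧ s ≤ ⨍⁻ x in ball b.1 b.2, f x ∂μ} R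
    (fun b hb => hb.1) (fun b hb => hb.2.1)
  have hS : S ⊆ ⋃ b ∈ u, ball b.1 (5 * b.2) := by
    intro y hy
    obtain ⟨a, h1, h2, h3, h4⟩ := h y hy
    obtain ⟨b, hb, -, hab⟩ := hcov a ⟨h1, h2, h4⟩
    exact mem_biUnion hb (hab h3)
  calc s * μ S ≤ s * ∑' b : u, μ (ball (b : X × ℝ).1 (5 * (b : X × ℝ).2)) := by
        gcongr; exact (measure_mono hS).trans (measure_biUnion_le μ huc _)
    _ ≤ s * ∑' b : u, ENNReal.ofReal (c * 5 ^ D) * μ (ball (b : X × ℝ).1 (b : X × ℝ).2) := by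
        gcongr with b
        exact hcD.measure_mul_le hμ _ (huT b.2).1 (by norm_num)
    _ = ENNReal.ofReal (c * 5 ^ D) * ∑' b : u, s * μ (ball (b : X × ℝ).1 (b : X × ℝ).2) := by
        rw [ENNReal.tsum_mul_left, ENNReal.tsum_mul_left]; ring
    _ ≤ ENNReal.ofReal (c * 5 ^ D) *
          ∑' b : u, ∫⁻ x in ball (b : X × ℝ).1 (b : X × ℝ).2, f x ∂μ := by
        gcongr with b
        have hb := (huT b.2).2.2.2
        rw [setLAverage_eq] at hb
        exact (ENNReal.le_div_iff_mul_le (Or.inl (hμ.pos _ _ (huT b.2).1).ne')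
          (Or.inl (hμ.ne_top _ _))).1 hb
    _ = ENNReal.ofReal (c * 5 ^ D) * ∫⁻ x in ⋃ b ∈ u, ball b.1 b.2, f x ∂μ := by
        rw [lintegral_biUnion huc (fun _ _ => isOpen_ball.measurableSet) hu]
    _ ≤ _ := by
        gcongr
        exact iUnion₂_subset fun b hb => (huT hb).2.2.1

end Basic

theorem ball_subset_of_mem_basis {X : Type*} [MetricSpace X] {x₀ : X} {r₀ η : ℝ}
    {b : X × ℝ} (hb : b ∈ basis x₀ r₀ η) :
    ball b.1 b.2 ⊆ ball x₀ ((1 + η) * r₀) := by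
  intro y hy
  have h1 := hb.1
  have h2 := hb.2.2
  simp only [mem_ball] at *
  linarith [dist_triangle y b.1 x₀]

/-! ### The maximal operator and Lebesgue differentiation -/

section Maximal

variable {X : Type*} [MetricSpace X] [MeasurableSpace X] {μ : Measure X}
  {x₀ : X} {r₀ η : ℝ}

theorem lt_maximal_iff {𝓑 : Set (X × ℝ)} {f : X → ℝ≥0∞} {x : X} {t : ℝ≥0∞} :
    t < maximal μ 𝓑 f x ↔
      ∃ b ∈ 𝓑, x ∈ ball b.1 b.2 ∧ t < ⨍⁻ y in ball b.1 b.2, f y ∂μ := by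
  simp only [maximal, lt_iSup_iff, exists_prop]

theorem le_maximal {𝓑 : Set (X × ℝ)} {f : X → ℝ≥0∞} {x : X} {b : X × ℝ} (hb : b ∈ 𝓑)
    (hx : x ∈ ball b.1 b.2) : ⨍⁻ y in ball b.1 b.2, f y ∂μ ≤ maximal μ 𝓑 f x :=
  le_iSup₂_of_le b hb (le_iSup_of_le hx le_rfl)

/-- The supremum may be uncountable, but its superlevel sets are unions of open balls, hence open.
-/
theorem measurable_biSup_ball [OpensMeasurableSpace X] (𝓑 : Set (X × ℝ)) (a : X × ℝ → ℝ≥0∞) :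
    Measurable fun x => ⨆ b ∈ 𝓑, ⨆ _ : x ∈ ball b.1 b.2, a b := by
  refine measurable_of_Ioi fun t => IsOpen.measurableSet ?_
  have : (fun x => ⨆ b ∈ 𝓑, ⨆ _ : x ∈ ball b.1 b.2, a b) ⁻¹' Ioi t =
      ⋃ b ∈ {b ∈ 𝓑 | t < a b}, ball b.1 b.2 := by
    ext x
    simp only [mem_preimage, mem_Ioi, lt_iSup_iff, exists_prop, mem_iUnion, mem_ofPred_eq]
    exact ⟨fun ⟨b, h1, h2, h3⟩ => ⟨b, ⟨h1, h3⟩, h2⟩, fun ⟨b, ⟨h1, h3⟩, h2⟩ => ⟨b, h1, h2, h3⟩⟩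
  rw [this]
  exact isOpen_biUnion fun _ _ => isOpen_ball

theorem measurable_maximal [OpensMeasurableSpace X] (𝓑 : Set (X × ℝ)) (f : X → ℝ≥0∞) :
    Measurable (maximal μ 𝓑 f) :=
  measurable_biSup_ball 𝓑 fun b => ⨍⁻ y in ball b.1 b.2, f y ∂μ

theorem measurable_gStar [OpensMeasurableSpace X] (𝓑 : Set (X × ℝ)) (g : X × ℝ → ℝ≥0) :
    Measurable (gStar 𝓑 g) :=
  measurable_biSup_ball 𝓑 fun b => (g b : ℝ≥0∞)

theorem setLAverage_le_measure_div_mul (hμ : IsDoubling μ) {b : X × ℝ}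
    (hb : b ∈ basis x₀ r₀ η) (hr₀ : 0 < r₀) (hη : 0 < η) (f : X → ℝ≥0∞) :
    ⨍⁻ y in ball b.1 b.2, f y ∂μ ≤ μ (ball x₀ ((1 + η) * r₀)) / μ (ball b.1 b.2) *
      ⨍⁻ y in ball x₀ ((1 + η) * r₀), f y ∂μ := by
  have h0 := hμ.pos x₀ ((1 + η) * r₀) (by positivity)
  rw [setLAverage_eq, setLAverage_eq, mul_comm, ← mul_div_assoc,
    ENNReal.div_mul_cancel h0.ne' (hμ.ne_top _ _)]
  gcongr
  exact ball_subset_of_mem_basis hb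

/-- By the Lebesgue differentiation theorem, a function is dominated by its maximal function. -/
theorem ae_le_maximal [BorelSpace X] (hμ : IsDoubling μ) (hr₀ : 0 < r₀) (hη : 0 < η)
    {F : X → ℝ≥0∞} (hF : IntegrableOn F (ball x₀ ((1 + η) * r₀)) μ) :
    ∀ᵐ x ∂μ.restrict (ball x₀ r₀), F x ≤ maximal μ (basis x₀ r₀ η) F x := by
  have := hμ.secondCountableTopology
  have := hμ.isLocallyFiniteMeasure
  have := hμ.isUnifLocDoublingMeasure
  set W := ball x₀ ((1 + η) * r₀) with hW
  have hWm : MeasurableSet W := isOpen_ball.measurableSet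
  have hsub : ball x₀ r₀ ⊆ W := ball_subset_ball (by nlinarith)
  -- Nothing is known of `F` outside `W`, so differentiation is applied to its extension by zero.
  have hmeas : AEMeasurable (W.indicator F) μ :=
    (aemeasurable_indicator_iff hWm).2 hF.1.aemeasurable
  have hfin : ∫⁻ y, W.indicator F y ∂μ ≠ ∞ := by
    rw [lintegral_indicator hWm]
    exact (by simpa [HasFiniteIntegral] using hF.2 : ∫⁻ y in W, F y ∂μ < ∞).ne
  rw [ae_restrict_iff' isOpen_ball.measurableSet]
  filter_upwards [(IsUnifLocDoublingMeasure.vitaliFamily μ 1).ae_tendsto_lintegral_div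
    hmeas hfin] with x hx hxB
  rw [indicator_of_mem (hsub hxB)] at hx
  have hd : Tendsto (fun r : ℝ => r) (𝓝[>] 0) (𝓝[>] 0) := tendsto_id
  have hlim := hx.comp (IsUnifLocDoublingMeasure.tendsto_closedBall_filterAt (K := 1) μ
    (x := x) (fun _ => x) _ hd (by
      filter_upwards [self_mem_nhdsWithin] with r hr
      exact mem_closedBall_self (by rw [one_mul]; exact le_of_lt hr)))
  refine le_of_tendsto hlim ?_
  filter_upwards [Ioo_mem_nhdsGT (show 0 < η * r₀ by positivity)] with r hr
  -- Differentiation yields closed balls while the basis consists of open ones: approximate the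
  -- closed ball from outside by slightly larger open balls, whose measures converge to its measure.
  have hanti : Antitone fun n : ℕ => ball x (r + 1 / ((n : ℝ) + 1)) := fun m n hmn =>
    ball_subset_ball (by gcongr)
  have hinter : ⋂ n : ℕ, ball x (r + 1 / ((n : ℝ) + 1)) = closedBall x r := by
    ext y
    simp only [mem_iInter, mem_ball, mem_closedBall]
    refine ⟨fun h => le_of_forall_pos_lt_add fun ε hε => ?_, fun h n => ?_⟩
    · obtain ⟨n, hn⟩ := exists_nat_one_div_lt hε
      linarith [h n]
    · have : 0 < 1 / ((n : ℝ) + 1) := by positivity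
      linarith
  have ht := tendsto_measure_iInter_atTop (μ := μ)
    (s := fun n : ℕ => ball x (r + 1 / ((n : ℝ) + 1)))
    (fun n => isOpen_ball.measurableSet.nullMeasurableSet) hanti ⟨0, hμ.ne_top _ _⟩
  rw [hinter] at ht
  have hpos : 0 < μ (closedBall x r) :=
    (hμ.pos x r hr.1).trans_le (measure_mono ball_subset_closedBall)
  have hbig : μ (closedBall x r) ≠ ∞ :=
    ((measure_mono (closedBall_subset_ball (lt_add_one r))).trans_lt
      (hμ.ne_top x (r + 1)).lt_top).ne
  change (∫⁻ y in closedBall x r, W.indicator F y ∂μ) / μ (closedBall x r) ≤ _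
  rw [ENNReal.div_le_iff hpos.ne' hbig]
  refine ge_of_tendsto (ENNReal.Tendsto.const_mul ht (Or.inl hpos.ne')) ?_
  have hs : Tendsto (fun n : ℕ => r + 1 / ((n : ℝ) + 1)) atTop (𝓝 (r + 0)) :=
    tendsto_const_nhds.add tendsto_one_div_add_atTop_nhds_zero_nat
  rw [add_zero] at hs
  filter_upwards [hs.eventually (gt_mem_nhds hr.2)] with n hn
  have hn0 : 0 < 1 / ((n : ℝ) + 1) := by positivity
  have hp : 0 < r + 1 / ((n : ℝ) + 1) := by linarith [hr.1]
  have hle := le_maximal (μ := μ) (f := F) (x := x)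
    (show (x, r + 1 / ((n : ℝ) + 1)) ∈ basis x₀ r₀ η from ⟨hxB, hp, hn.le⟩) (mem_ball_self hp)
  rw [setLAverage_eq, ENNReal.div_le_iff (hμ.pos _ _ hp).ne' (hμ.ne_top _ _)] at hle
  refine le_trans ?_ hle
  calc ∫⁻ y in closedBall x r, W.indicator F y ∂μ
      ≤ ∫⁻ y in closedBall x r, F y ∂μ := by
        gcongr with y; exact indicator_le_self _ _ y
    _ ≤ _ := lintegral_mono_set (closedBall_subset_ball (by linarith))

end Maximal

/-! ### The good-lambda inequality -/

section GoodLambdaInequality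

variable {X : Type*} [MetricSpace X] [MeasurableSpace X] {μ : Measure X} {c D : ℝ}
  {x₀ : X} {r₀ η τ Θ δ : ℝ} {F : X → ℝ≥0∞} {G H : X × ℝ → X → ℝ≥0∞} {g : X × ℝ → ℝ≥0}

/-- Comparison of averages of `F` and `G b` on subsets of a ball `b` of the basis. -/
theorem Admissible.setLAverage_le (hA : Admissible μ x₀ r₀ η τ Θ δ F G H g) {b : X × ℝ}
    (hb : b ∈ basis x₀ r₀ η) {B : Set X} (hB : B ⊆ ball b.1 b.2) (h0 : μ B ≠ 0)
    (h1 : μ B ≠ ∞) :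
    ⨍⁻ x in B, F x ∂μ ≤ ⨍⁻ x in B, G b x ∂μ +
      ENNReal.ofReal Θ * ⨍⁻ x in ball b.1 (τ * b.2), F x ∂μ := by
  have hH : ∀ᵐ x ∂μ.restrict (ball b.1 b.2),
      H b x ≤ ENNReal.ofReal Θ * ⨍⁻ x in ball b.1 (τ * b.2), F x ∂μ := by
    filter_upwards [enorm_ae_le_eLpNormEssSup (H b) (μ.restrict (ball b.1 b.2))] with x hx
    rw [← eLpNorm_exponent_top, enorm_eq_self] at hx
    exact hx.trans (hA.norm_H b hb)
  have hF : ∀ᵐ x ∂μ.restrict B,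
      F x ≤ G b x + ENNReal.ofReal Θ * ⨍⁻ x in ball b.1 (τ * b.2), F x ∂μ := by
    refine ae_restrict_of_ae_restrict_of_subset hB ?_
    filter_upwards [hH, hA.le_add b hb] with x h1 h2
    exact h2.trans (by gcongr)
  refine (laverage_mono_ae hF).trans_eq ?_
  rw [setLAverage_eq, lintegral_add_right _ measurable_const, ENNReal.add_div,
    ← setLAverage_eq, lintegral_const, Measure.restrict_apply_univ,
    ENNReal.mul_div_cancel_right h0 h1]

/-- The good-lambda inequality at levels where balls with large average are small. -/
theorem Admissible.measure_goodLambda_le [BorelSpace X] (hμ : IsDoubling μ)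
    (hcD : HasDoublingConstants μ c D) (hτ : 1 ≤ τ) (hΘ : 1 ≤ Θ) (hδ : 0 ≤ δ)
    (hA : Admissible μ x₀ r₀ η τ Θ δ F G H g) {lam K γ : ℝ} (hlam : 0 < lam)
    (hsmall : ∀ b ∈ basis x₀ r₀ η, ENNReal.ofReal lam < ⨍⁻ x in ball b.1 b.2, F x ∂μ →
      τ * (13 * b.2) ≤ η * r₀) (hK : Θ < K) (hγ : 0 < γ) :
    μ {x ∈ ball x₀ ((1 + η) * r₀) |
        ENNReal.ofReal (K * lam) < maximal μ (basis x₀ r₀ η) F x ∧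
        gStar (basis x₀ r₀ η) g x ≤ ENNReal.ofReal (γ * lam)} ≤
      ENNReal.ofReal (c * 5 ^ D * (c * 13 ^ D) * ((δ + γ) / (K - Θ))) *
        μ {x ∈ ball x₀ ((1 + η) * r₀) |
          ENNReal.ofReal lam < maximal μ (basis x₀ r₀ η) F x} := by
  have := hμ.secondCountableTopology
  have hc : 1 ≤ c := hcD.one_le hμ x₀
  set E := {x ∈ ball x₀ ((1 + η) * r₀) |
    ENNReal.ofReal (K * lam) < maximal μ (basis x₀ r₀ η) F x ∧
    gStar (basis x₀ r₀ η) g x ≤ ENNReal.ofReal (γ * lam)} with hE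
  set Ω := {x ∈ ball x₀ ((1 + η) * r₀) |
    ENNReal.ofReal lam < maximal μ (basis x₀ r₀ η) F x} with hΩ
  have hKlam : ENNReal.ofReal lam ≤ ENNReal.ofReal (K * lam) :=
    ENNReal.ofReal_le_ofReal (by nlinarith)
  let L : Set (X × ℝ) :=
    {b ∈ basis x₀ r₀ η | ENNReal.ofReal lam < ⨍⁻ x in ball b.1 b.2, F x ∂μ}
  -- The largest radius at a point need not be attained, hence near maximality up to a factor 2.
  let T : Set (X × ℝ) := {b ∈ L | ∃ x ∈ ball b.1 b.2, ∀ b' ∈ L, x ∈ ball b'.1 b'.2 →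
    b'.2 ≤ 2 * b.2}
  have hLT : ∀ x, ∀ b ∈ L, x ∈ ball b.1 b.2 →
      ∃ b ∈ T, x ∈ ball b.1 b.2 ∧ ∀ b' ∈ L, x ∈ ball b'.1 b'.2 → b'.2 ≤ 2 * b.2 := by
    intro x b hb hx
    let S : Set ℝ := (fun b : X × ℝ => b.2) '' {b ∈ L | x ∈ ball b.1 b.2}
    have hS : BddAbove S := by
      refine ⟨η * r₀, ?_⟩
      rintro _ ⟨b, hb, rfl⟩
      exact hb.1.1.2.2
    have hbS : b.2 ∈ S := ⟨b, ⟨hb, hx⟩, rfl⟩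
    have hpos : 0 < sSup S := hb.1.2.1.trans_le (le_csSup hS hbS)
    obtain ⟨_, ⟨b', hb', rfl⟩, hlt⟩ := exists_lt_of_lt_csSup ⟨_, hbS⟩ (half_lt_self hpos)
    have key : ∀ b'' ∈ L, x ∈ ball b''.1 b''.2 → b''.2 ≤ 2 * b'.2 := fun b'' h1 h2 => by
      have : b''.2 ≤ sSup S := le_csSup hS ⟨b'', ⟨h1, h2⟩, rfl⟩
      simp only at hlt
      linarith
    exact ⟨b', ⟨hb'.1, x, hb'.2, key⟩, hb'.2, key⟩
  obtain ⟨u, huT, huc, hu, hcov⟩ := exists_disjoint_balls T (η * r₀) (fun b hb => hb.1.1.2.1)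
    (fun b hb => hb.1.1.2.2)
  -- The constant 13: if `y ∈ a ⊆ 5b` with `r_a ≤ 2 r_b`, any ball of `L` containing `y` has radius
  -- at most `2 r_a ≤ 4 r_b`, so it lies in the dilate of `b` by `5 + 2 · 4`.
  let A : X × ℝ → Set X := fun b => {y ∈ E | y ∈ ball b.1 (13 * b.2) ∧
    ∃ b' ∈ L, ball b'.1 b'.2 ⊆ ball b.1 (13 * b.2) ∧ y ∈ ball b'.1 b'.2 ∧
      ENNReal.ofReal (K * lam) < ⨍⁻ x in ball b'.1 b'.2, F x ∂μ}
  have hEA : E ⊆ ⋃ b ∈ u, A b := by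
    intro y hy
    obtain ⟨b', hb', hyb', hlt⟩ := lt_maximal_iff.1 hy.2.1
    have hb'L : b' ∈ L := ⟨hb', hKlam.trans_lt hlt⟩
    obtain ⟨a, haT, hya, ha⟩ := hLT y b' hb'L hyb'
    obtain ⟨b, hb, hab, hsub⟩ := hcov a haT
    have hyb := hsub hya
    have hrad := ha b' hb'L hyb'
    have hb0 : 0 < b.2 := (huT hb).1.1.2.1
    refine mem_biUnion hb ⟨hy, ball_subset_ball (by linarith) hyb, b', hb'L, fun w hw => ?_,
      hyb', hlt⟩
    rw [mem_ball] at *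
    linarith [dist_triangle w b'.1 b.1,
      dist_triangle_left b'.1 b.1 y]
  have hAb : ∀ b ∈ u, μ (A b) ≤
      ENNReal.ofReal (c * 5 ^ D * (c * 13 ^ D) * ((δ + γ) / (K - Θ))) * μ (ball b.1 b.2) := by
    intro b hbu
    obtain ⟨hbL, z, hz, hzmax⟩ := huT hbu
    have hb2 : 0 < b.2 := hbL.1.2.1
    have hsm := hsmall b hbL.1 hbL.2
    have h13 : (13 : ℝ) * b.2 ≤ η * r₀ := by nlinarith
    have hB : (b.1, 13 * b.2) ∈ basis x₀ r₀ η := ⟨hbL.1.1, by positivity, h13⟩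
    have hτB : (b.1, τ * (13 * b.2)) ∈ basis x₀ r₀ η := ⟨hbL.1.1, by positivity, hsm⟩
    -- The dilate contains the point `z` at which `b` is nearly maximal, and its radius exceeds `2
    -- r_b`; an average above `λ` would contradict that.
    have havg : ⨍⁻ x in ball b.1 (τ * (13 * b.2)), F x ∂μ ≤ ENNReal.ofReal lam := by
      by_contra! hlt
      have hτb : 13 * b.2 ≤ τ * (13 * b.2) := by nlinarith
      have := hzmax (b.1, τ * (13 * b.2)) ⟨hτB, hlt⟩
        (ball_subset_ball (by linarith) hz)
      simp only at this
      linarith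
    rcases (A b).eq_empty_or_nonempty with hemp | ⟨y₀, hy₀⟩
    · simp [hemp]
    -- A single point of `A b` lies in `13b` and has `G* ≤ γλ`, which controls the constant of
    -- `13b`.
    have hg : (g (b.1, 13 * b.2) : ℝ≥0∞) ≤ ENNReal.ofReal (γ * lam) :=
      le_trans (le_iSup₂_of_le (b.1, 13 * b.2) hB
        (le_iSup (fun _ : y₀ ∈ ball b.1 (13 * b.2) => (g (b.1, 13 * b.2) : ℝ≥0∞)) hy₀.2.1))
        hy₀.1.2.2
    have hweak := mul_measure_le_lintegral hμ hcD (S := A b) (W := ball b.1 (13 * b.2))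
      (R := η * r₀) (f := G (b.1, 13 * b.2)) (s := ENNReal.ofReal ((K - Θ) * lam)) (by
        rintro y ⟨-, -, b', hb', hsub, hyb', hlt⟩
        refine ⟨b', hb'.1.2.1, hb'.1.2.2, hyb', hsub, ?_⟩
        have h1 := hA.setLAverage_le hB hsub (hμ.pos _ _ hb'.1.2.1).ne' (hμ.ne_top _ _)
        have h2 : ENNReal.ofReal (K * lam) ≤
            ⨍⁻ x in ball b'.1 b'.2, G (b.1, 13 * b.2) x ∂μ + ENNReal.ofReal (Θ * lam) := by
          rw [ENNReal.ofReal_mul (p := Θ) (by linarith)]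
          exact hlt.le.trans (h1.trans (by gcongr))
        rw [sub_mul, ENNReal.ofReal_sub _ (by nlinarith)]
        exact tsub_le_iff_right.2 h2)
    have hG : ∫⁻ x in ball b.1 (13 * b.2), G (b.1, 13 * b.2) x ∂μ ≤
        ENNReal.ofReal ((δ + γ) * lam) * (ENNReal.ofReal (c * 13 ^ D) * μ (ball b.1 b.2)) := by
      have h1 := hA.average_G _ hB
      rw [setLAverage_eq] at h1
      have h2 := (ENNReal.div_le_iff (hμ.pos b.1 (13 * b.2) (by positivity)).ne'
        (hμ.ne_top _ _)).1 h1
      refine h2.trans (mul_le_mul' ?_ (hcD.measure_mul_le hμ _ hb2 (by norm_num)))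
      rw [add_mul, ENNReal.ofReal_add (by positivity) (by positivity), ENNReal.ofReal_mul hδ]
      gcongr
    have hKΘ : 0 < (K - Θ) * lam := mul_pos (by linarith) hlam
    have h3 := hweak.trans (mul_le_mul_right hG _)
    rw [mul_comm] at h3
    have h4 := ENNReal.le_div_iff_mul_le (Or.inl (ENNReal.ofReal_pos.2 hKΘ).ne')
      (Or.inl ENNReal.ofReal_ne_top) |>.2 h3
    refine h4.trans_eq ?_
    rw [← mul_assoc, ← mul_assoc, ← ENNReal.ofReal_mul (by positivity),
      ← ENNReal.ofReal_mul (by positivity), ENNReal.mul_div_right_comm,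
      ← ENNReal.ofReal_div_of_pos hKΘ]
    congr 2
    have : K - Θ ≠ 0 := by linarith
    field_simp
  calc μ E ≤ ∑' b : u, μ (A b) := (measure_mono hEA).trans (measure_biUnion_le μ huc _)
    _ ≤ ∑' b : u, ENNReal.ofReal (c * 5 ^ D * (c * 13 ^ D) * ((δ + γ) / (K - Θ))) *
          μ (ball (b : X × ℝ).1 (b : X × ℝ).2) := ENNReal.tsum_le_tsum fun b => hAb b b.2
    _ = ENNReal.ofReal (c * 5 ^ D * (c * 13 ^ D) * ((δ + γ) / (K - Θ))) *
          μ (⋃ b ∈ u, ball b.1 b.2) := by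
        rw [ENNReal.tsum_mul_left, measure_biUnion huc hu fun _ _ => isOpen_ball.measurableSet]
    _ ≤ _ := by
        gcongr
        refine iUnion₂_subset fun b hb y hy => ?_
        exact ⟨ball_subset_of_mem_basis (huT hb).1.1 hy,
          lt_maximal_iff.2 ⟨b, (huT hb).1.1, hy, (huT hb).1.2⟩⟩

/-- Balls of the basis on which the average is much larger than the average over the enlarged
ball have small radius. -/
theorem radius_le_of_lt_setLAverage (hμ : IsDoubling μ)
    (hcD : HasDoublingConstants μ c D) (hr₀ : 0 < r₀) (hη : 0 < η) {ρ : ℝ} (hρ : 1 ≤ ρ)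
    {b : X × ℝ}
    (hb : b ∈ basis x₀ r₀ η)
    (h : ENNReal.ofReal (c * ((2 + η) * ρ / η) ^ D) * ⨍⁻ x in ball x₀ ((1 + η) * r₀), F x ∂μ
      < ⨍⁻ x in ball b.1 b.2, F x ∂μ) : ρ * b.2 ≤ η * r₀ := by
  by_contra! hlt
  refine absurd h (not_lt.2 ?_)
  have hb2 : 0 < b.2 := hb.2.1
  -- The center of `b` is within `r₀` of `x₀`, so radius `(2 + η) r₀` around it captures the
  -- enlarged ball.
  have hkr : (2 + η) * r₀ ≤ (2 + η) * ρ / η * b.2 := by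
    rw [div_mul_eq_mul_div, le_div_iff₀ hη]
    nlinarith
  have hk : 1 ≤ (2 + η) * ρ / η := by
    rw [le_div_iff₀ hη]
    nlinarith
  have hsub : ball x₀ ((1 + η) * r₀) ⊆ ball b.1 ((2 + η) * ρ / η * b.2) := by
    refine (ball_subset_ball' ?_).trans (ball_subset_ball hkr)
    have := hb.1
    rw [mem_ball, dist_comm] at this
    linarith
  refine (setLAverage_le_measure_div_mul hμ hb hr₀ hη F).trans ?_
  gcongr
  rw [ENNReal.div_le_iff (hμ.pos _ _ hb2).ne' (hμ.ne_top _ _)]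
  exact (measure_mono hsub).trans (hcD.measure_mul_le hμ _ hb2 hk)

theorem Admissible.setLAverage_ne_top (hμ : IsDoubling μ) (hr₀ : 0 < r₀) (hη : 0 < η)
    (hA : Admissible μ x₀ r₀ η τ Θ δ F G H g) :
    ⨍⁻ x in ball x₀ ((1 + η) * r₀), F x ∂μ ≠ ∞ := by
  have h : ∫⁻ x in ball x₀ ((1 + η) * r₀), F x ∂μ < ∞ := by
    simpa [HasFiniteIntegral] using hA.integrable.2
  rw [setLAverage_eq]
  exact ENNReal.div_ne_top h.ne (hμ.pos _ _ (by positivity)).ne'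

/-- The good-lambda inequality at levels above a multiple of the average of `F`. -/
theorem Admissible.measure_goodLambda_le_of_le [BorelSpace X] (hμ : IsDoubling μ)
    (hcD : HasDoublingConstants μ c D) (hη : 0 < η) (hr₀ : 0 < r₀) (hτ : 1 ≤ τ) (hΘ : 1 ≤ Θ)
    (hδ : 0 ≤ δ) (hA : Admissible μ x₀ r₀ η τ Θ δ F G H g) {lam₀ lam K γ : ℝ}
    (hlam₀ : max 1 (c * ((2 + η) * (τ * 13) / η) ^ D) ≤ lam₀)
    (hlam : lam₀ * (⨍⁻ x in ball x₀ ((1 + η) * r₀), F x ∂μ).toReal ≤ lam)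
    (hK : Θ < K) (hγ : 0 < γ) :
    μ {x ∈ ball x₀ ((1 + η) * r₀) |
        ENNReal.ofReal (K * lam) < maximal μ (basis x₀ r₀ η) F x ∧
        gStar (basis x₀ r₀ η) g x ≤ ENNReal.ofReal (γ * lam)} ≤
      ENNReal.ofReal (c * 5 ^ D * (c * 13 ^ D) * ((δ + γ) / (K - Θ))) *
        μ {x ∈ ball x₀ ((1 + η) * r₀) |
          ENNReal.ofReal lam < maximal μ (basis x₀ r₀ η) F x} := by
  have hfin := hA.setLAverage_ne_top hμ hr₀ hη
  have hlam₀1 : 1 ≤ lam₀ := (le_max_left _ _).trans hlam₀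
  rcases le_or_gt lam 0 with hlam0 | hlam0
  -- Since `lam₀ ≥ 1`, a level `lam ≤ 0` forces the average of `F` to vanish, and the maximal
  -- function with it.
  · have hzero : ⨍⁻ x in ball x₀ ((1 + η) * r₀), F x ∂μ = 0 := by
      have h1 : (⨍⁻ x in ball x₀ ((1 + η) * r₀), F x ∂μ).toReal = 0 := by
        have := ENNReal.toReal_nonneg (a := ⨍⁻ x in ball x₀ ((1 + η) * r₀), F x ∂μ)
        nlinarith
      exact ((ENNReal.toReal_eq_zero_iff _).1 h1).resolve_right hfin
    have hemp : {x ∈ ball x₀ ((1 + η) * r₀) |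
        ENNReal.ofReal (K * lam) < maximal μ (basis x₀ r₀ η) F x ∧
        gStar (basis x₀ r₀ η) g x ≤ ENNReal.ofReal (γ * lam)} = ∅ := by
      refine eq_empty_of_forall_notMem fun x hx => ?_
      obtain ⟨b, hb, -, hlt⟩ := lt_maximal_iff.1 hx.2.1
      have := setLAverage_le_measure_div_mul hμ hb hr₀ hη F
      rw [hzero, mul_zero] at this
      exact absurd (hlt.trans_le this) not_lt_zero
    rw [hemp]
    simp
  · refine hA.measure_goodLambda_le hμ hcD hτ hΘ hδ hlam0 (fun b hb hlt => ?_) hK hγ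
    rw [← mul_assoc]
    refine radius_le_of_lt_setLAverage hμ hcD hr₀ hη (by linarith) hb
      (lt_of_le_of_lt ?_ hlt)
    rw [← ENNReal.ofReal_toReal hfin, ← ENNReal.ofReal_mul' ENNReal.toReal_nonneg]
    refine ENNReal.ofReal_le_ofReal (le_trans ?_ hlam)
    gcongr
    exact (le_max_right _ _).trans hlam₀

end GoodLambdaInequality

/-! ### From distribution inequalities to weak and strong norms -/

section Distribution

variable {Ω : Type*} [MeasurableSpace Ω] {ν : Measure Ω} {p : ℝ}

/-- The weak `L^p` norm with respect to an arbitrary measure. -/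
noncomputable def weakLpNorm (ν : Measure Ω) (p : ℝ) (f : Ω → ℝ≥0∞) : ℝ≥0∞ :=
  ⨆ t : ℝ≥0, (t : ℝ≥0∞) * ν {x | (t : ℝ≥0∞) < f x} ^ (1 / p)

theorem le_weakLpNorm (f : Ω → ℝ≥0∞) (t : ℝ≥0) :
    (t : ℝ≥0∞) * ν {x | (t : ℝ≥0∞) < f x} ^ (1 / p) ≤ weakLpNorm ν p f :=
  le_iSup (fun t : ℝ≥0 => (t : ℝ≥0∞) * ν {x | (t : ℝ≥0∞) < f x} ^ (1 / p)) t

theorem weakLpNorm_mono_ae (hp : 0 < p) {f g : Ω → ℝ≥0∞} (h : ∀ᵐ x ∂ν, f x ≤ g x) :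
    weakLpNorm ν p f ≤ weakLpNorm ν p g := by
  refine iSup_mono fun t => ?_
  refine mul_le_mul_right (ENNReal.rpow_le_rpow (measure_mono_ae ?_) (by positivity)) _
  filter_upwards [h] with x hx hx'
  exact lt_of_lt_of_le hx' hx

theorem weakLpNorm_le_of_measure_le (hp : 0 < p) {ν' : Measure Ω} {k : ℝ≥0∞} (h : ν ≤ k • ν')
    (f : Ω → ℝ≥0∞) : weakLpNorm ν p f ≤ k ^ (1 / p) * weakLpNorm ν' p f := by
  refine iSup_le fun t => ?_
  have hp' : 0 ≤ 1 / p := by positivity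
  calc (t : ℝ≥0∞) * ν {x | (t : ℝ≥0∞) < f x} ^ (1 / p)
      ≤ t * (k * ν' {x | (t : ℝ≥0∞) < f x}) ^ (1 / p) := by gcongr; exact h _
    _ = k ^ (1 / p) * (t * ν' {x | (t : ℝ≥0∞) < f x} ^ (1 / p)) := by
        rw [ENNReal.mul_rpow_of_nonneg _ _ hp']; ring
    _ ≤ _ := by gcongr; exact le_weakLpNorm f t

theorem lt_mul_iff_div_lt {k : ℝ≥0} (hk : k ≠ 0) (t : ℝ≥0) (y : ℝ≥0∞) :
    (t : ℝ≥0∞) < k * y ↔ ((t / k : ℝ≥0) : ℝ≥0∞) < y := by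
  rw [ENNReal.coe_div hk, mul_comm, ENNReal.div_lt_iff (Or.inl (by simpa using hk))
    (Or.inl ENNReal.coe_ne_top)]

theorem mul_measure_lt_mul_le (f : Ω → ℝ≥0∞) {k : ℝ≥0} (hk : k ≠ 0) (t : ℝ≥0) :
    (t : ℝ≥0∞) * ν {x | (t : ℝ≥0∞) < k * f x} ^ (1 / p) ≤ k * weakLpNorm ν p f := by
  simp only [lt_mul_iff_div_lt hk]
  calc (t : ℝ≥0∞) * ν {x | ((t / k : ℝ≥0) : ℝ≥0∞) < f x} ^ (1 / p)
      = k * (((t / k : ℝ≥0) : ℝ≥0∞) * ν {x | ((t / k : ℝ≥0) : ℝ≥0∞) < f x} ^ (1 / p)) := by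
        rw [← mul_assoc, ← ENNReal.coe_mul, mul_div_cancel₀ _ hk]
    _ ≤ _ := by gcongr; exact le_weakLpNorm f _

/-- The absorption step. Finiteness of `x` is essential, and is why it is applied to truncations. -/
theorem le_inv_mul_of_le_add_mul {x y θ : ℝ≥0∞} (hx : x ≠ ∞) (hθ : θ < 1)
    (h : x ≤ y + θ * x) : x ≤ (1 - θ)⁻¹ * y := by
  have h0 : 1 - θ ≠ 0 := (tsub_pos_of_lt hθ).ne'
  have h1 : 1 - θ ≠ ∞ := ENNReal.sub_ne_top ENNReal.one_ne_top
  rw [mul_comm, ← div_eq_mul_inv, ENNReal.le_div_iff_mul_le (Or.inl h0) (Or.inl h1), mul_comm,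
    ENNReal.sub_mul (fun _ _ => hx), one_mul]
  exact tsub_le_iff_right.2 h

/-- A good-lambda inequality is inherited by truncations, in a form valid at all levels. -/
theorem measure_lt_min_le [IsProbabilityMeasure ν] {f h : Ω → ℝ≥0∞} {a β q K : ℝ≥0}
    (hβ : 1 ≤ β) (hK : 1 ≤ K)
    (hyp : ∀ t : ℝ≥0, a ≤ t → ν {x | (t : ℝ≥0∞) < f x} ≤
      ν {x | (t : ℝ≥0∞) < β * h x} + q * ν {x | (t : ℝ≥0∞) < K * f x}) (T t : ℝ≥0) :
    ν {x | (t : ℝ≥0∞) < min (f x) T} ≤ ν {_x | (t : ℝ≥0∞) < a} +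
      ν {x | (t : ℝ≥0∞) < β * min (h x) T} + q * ν {x | (t : ℝ≥0∞) < K * min (f x) T} := by
  rcases lt_or_ge t a with hta | hta
  · have h1 : {_x : Ω | (t : ℝ≥0∞) < a} = univ :=
      eq_univ_of_forall fun _ => ENNReal.coe_lt_coe.2 hta
    rw [h1, measure_univ, add_assoc]
    exact prob_le_one.trans le_self_add
  rcases le_or_gt T t with hTt | hTt
  · have h1 : {x | (t : ℝ≥0∞) < min (f x) T} = ∅ := eq_empty_of_forall_notMem fun x hx =>
      absurd (lt_of_lt_of_le hx (min_le_right _ _)) (not_lt.2 (ENNReal.coe_le_coe.2 hTt))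
    rw [h1, measure_empty]
    exact zero_le
  -- For levels below `T`, a factor `k ≥ 1` makes truncation at `T` harmless.
  have key : ∀ (k : ℝ≥0) (y : ℝ≥0∞), 1 ≤ k → (t : ℝ≥0∞) < k * y → (t : ℝ≥0∞) < k * min y T := by
    intro k y hk hy
    rcases le_total y T with hyT | hyT
    · rwa [min_eq_left hyT]
    · rw [min_eq_right hyT]
      calc (t : ℝ≥0∞) < T := ENNReal.coe_lt_coe.2 hTt
        _ ≤ k * T := le_mul_of_one_le_left' (ENNReal.one_le_coe_iff.2 hk)
  calc ν {x | (t : ℝ≥0∞) < min (f x) T} ≤ ν {x | (t : ℝ≥0∞) < f x} :=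
        measure_mono fun x (hx : _ < min (f x) _) => hx.trans_le (min_le_left _ _)
    _ ≤ _ := hyp t hta
    _ ≤ ν {x | (t : ℝ≥0∞) < β * min (h x) T} + q * ν {x | (t : ℝ≥0∞) < K * min (f x) T} := by
        gcongr ν ?_ + q * ν ?_
        · exact fun x hx => key β _ hβ hx
        · exact fun x hx => key K _ hK hx
    _ ≤ _ := by gcongr; exact le_add_self

theorem weakLpNorm_le_of_goodLambda [IsProbabilityMeasure ν] (hp : 1 ≤ p) {f h : Ω → ℝ≥0∞}
    {a β q K : ℝ≥0} (hβ : 1 ≤ β) (hK : 1 ≤ K) (hq : (q : ℝ≥0∞) ^ (1 / p) * K < 1)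
    (hyp : ∀ t : ℝ≥0, a ≤ t → ν {x | (t : ℝ≥0∞) < f x} ≤
      ν {x | (t : ℝ≥0∞) < β * h x} + q * ν {x | (t : ℝ≥0∞) < K * f x}) :
    weakLpNorm ν p f ≤ (1 - (q : ℝ≥0∞) ^ (1 / p) * K)⁻¹ * (a + β * weakLpNorm ν p h) := by
  have hp0 : 0 < p := by linarith
  have hp' : 0 ≤ 1 / p := by positivity
  have hp1 : 1 / p ≤ 1 := by rw [div_le_one hp0]; exact hp
  have hle1 : ∀ S : Set Ω, ν S ^ (1 / p) ≤ 1 := fun S =>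
    ENNReal.rpow_le_one prob_le_one hp'
  have htrunc : ∀ T : ℝ≥0, weakLpNorm ν p (fun x => min (f x) T) ≤
      (1 - (q : ℝ≥0∞) ^ (1 / p) * K)⁻¹ * (a + β * weakLpNorm ν p h) := by
    intro T
    refine le_inv_mul_of_le_add_mul ?_ hq ?_
    · refine ne_top_of_le_ne_top (ENNReal.coe_ne_top (r := T)) (iSup_le fun t => ?_)
      rcases le_or_gt t T with htT | htT
      · calc (t : ℝ≥0∞) * _ ≤ t * 1 := by gcongr; exact hle1 _
          _ ≤ T := by rw [mul_one]; exact ENNReal.coe_le_coe.2 htT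
      · have h1 : {x | (t : ℝ≥0∞) < min (f x) T} = ∅ := eq_empty_of_forall_notMem fun x hx =>
          absurd (lt_of_lt_of_le hx (min_le_right _ _))
            (not_lt.2 (ENNReal.coe_le_coe.2 htT.le))
        rw [h1, measure_empty, ENNReal.zero_rpow_of_pos (by positivity), mul_zero]
        exact zero_le
    · refine iSup_le fun t => ?_
      have h1 : (t : ℝ≥0∞) * ν {_x : Ω | (t : ℝ≥0∞) < a} ^ (1 / p) ≤ a := by
        rcases lt_or_ge t a with hta | hta
        · calc (t : ℝ≥0∞) * _ ≤ t * 1 := by gcongr; exact hle1 _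
            _ ≤ a := by rw [mul_one]; exact ENNReal.coe_le_coe.2 hta.le
        · have h1 : {_x : Ω | (t : ℝ≥0∞) < a} = ∅ := eq_empty_of_forall_notMem fun x hx =>
            absurd hx (not_lt.2 (ENNReal.coe_le_coe.2 hta))
          rw [h1, measure_empty, ENNReal.zero_rpow_of_pos (by positivity), mul_zero]
          exact zero_le
      have h2 : (t : ℝ≥0∞) * ν {x | (t : ℝ≥0∞) < β * min (h x) T} ^ (1 / p) ≤
          β * weakLpNorm ν p h :=
        (mul_measure_lt_mul_le _ (by positivity) t).trans (by
          gcongr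
          exact weakLpNorm_mono_ae hp0 (ae_of_all _ fun x => min_le_left _ _))
      have h3 := mul_measure_lt_mul_le (ν := ν) (p := p) (fun x => min (f x) T) (k := K)
        (by positivity) t
      calc (t : ℝ≥0∞) * ν {x | (t : ℝ≥0∞) < min (f x) T} ^ (1 / p)
          ≤ t * (ν {_x | (t : ℝ≥0∞) < a} + ν {x | (t : ℝ≥0∞) < β * min (h x) T} +
              q * ν {x | (t : ℝ≥0∞) < K * min (f x) T}) ^ (1 / p) := by
            gcongr; exact measure_lt_min_le hβ hK hyp T t
        _ ≤ t * (ν {_x | (t : ℝ≥0∞) < a} ^ (1 / p) +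
              ν {x | (t : ℝ≥0∞) < β * min (h x) T} ^ (1 / p) +
              (q * ν {x | (t : ℝ≥0∞) < K * min (f x) T}) ^ (1 / p)) := by
            gcongr
            refine (ENNReal.rpow_add_le_add_rpow _ _ hp' hp1).trans ?_
            gcongr
            exact ENNReal.rpow_add_le_add_rpow _ _ hp' hp1
        _ = t * ν {_x | (t : ℝ≥0∞) < a} ^ (1 / p) +
              t * ν {x | (t : ℝ≥0∞) < β * min (h x) T} ^ (1 / p) +
              (q : ℝ≥0∞) ^ (1 / p) *
                (t * ν {x | (t : ℝ≥0∞) < K * min (f x) T} ^ (1 / p)) := by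
            rw [ENNReal.mul_rpow_of_nonneg _ _ hp']; ring
        _ ≤ a + β * weakLpNorm ν p h +
              (q : ℝ≥0∞) ^ (1 / p) * (K * weakLpNorm ν p fun x => min (f x) T) := by
            gcongr
        _ = _ := by rw [mul_assoc]
  -- At level `t` the truncation at `t + 1` is invisible.
  refine iSup_le fun t => ?_
  refine le_trans ?_ (htrunc (t + 1))
  refine le_trans (le_of_eq ?_) (le_weakLpNorm (fun x => min (f x) ((t + 1 : ℝ≥0) : ℝ≥0∞)) t)
  congr 3
  ext x
  have : (t : ℝ≥0∞) < ((t + 1 : ℝ≥0) : ℝ≥0∞) := ENNReal.coe_lt_coe.2 (lt_add_one t)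
  simp only [mem_ofPred_eq, lt_min_iff, this, and_true]

/-- Layer-cake formula; finiteness allows passage to the real-valued version, and truncations supply
it. -/
theorem lintegral_rpow_eq_lintegral_measure_lt (hp : 0 < p) {u : Ω → ℝ≥0∞}
    (hu : Measurable u) (hfin : ∀ x, u x ≠ ∞) :
    ∫⁻ x, u x ^ p ∂ν = ENNReal.ofReal p *
      ∫⁻ t in Ioi (0 : ℝ), ν {x | ENNReal.ofReal t < u x} * ENNReal.ofReal (t ^ (p - 1)) := by
  have h := lintegral_rpow_eq_lintegral_meas_lt_mul ν (f := fun x => (u x).toReal)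
    (ae_of_all _ fun x => ENNReal.toReal_nonneg) hu.ennreal_toReal.aemeasurable hp
  have h1 : ∀ x, ENNReal.ofReal ((u x).toReal ^ p) = u x ^ p := fun x => by
    rw [← ENNReal.ofReal_rpow_of_nonneg ENNReal.toReal_nonneg hp.le,
      ENNReal.ofReal_toReal (hfin x)]
  simp only [h1] at h
  rw [h]
  congr 1
  refine setLIntegral_congr_fun measurableSet_Ioi fun t ht => ?_
  have ht : 0 < t := ht
  simp only [ENNReal.ofReal_lt_iff_lt_toReal ht.le (hfin _)]

theorem lintegral_rpow_le_of_goodLambda [IsProbabilityMeasure ν] (hp : 0 < p)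
    {f h : Ω → ℝ≥0∞} (hf : Measurable f) (hh : Measurable h) {a β q K : ℝ≥0} (hβ : 1 ≤ β)
    (hK : 1 ≤ K) (hq : (q : ℝ≥0∞) * (K : ℝ≥0∞) ^ p < 1)
    (hyp : ∀ t : ℝ≥0, a ≤ t → ν {x | (t : ℝ≥0∞) < f x} ≤
      ν {x | (t : ℝ≥0∞) < β * h x} + q * ν {x | (t : ℝ≥0∞) < K * f x}) :
    ∫⁻ x, f x ^ p ∂ν ≤ (1 - (q : ℝ≥0∞) * (K : ℝ≥0∞) ^ p)⁻¹ *
      ((a : ℝ≥0∞) ^ p + (β : ℝ≥0∞) ^ p * ∫⁻ x, h x ^ p ∂ν) := by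
  have htrunc : ∀ T : ℝ≥0, ∫⁻ x, min (f x) T ^ p ∂ν ≤
      (1 - (q : ℝ≥0∞) * (K : ℝ≥0∞) ^ p)⁻¹ *
        ((a : ℝ≥0∞) ^ p + (β : ℝ≥0∞) ^ p * ∫⁻ x, h x ^ p ∂ν) := by
    intro T
    have hmT : ∀ y : ℝ≥0∞, min y T ≠ ∞ := fun y =>
      ne_top_of_le_ne_top (ENNReal.coe_ne_top (r := T)) (min_le_right _ _)
    have hu : Measurable fun x => min (f x) (T : ℝ≥0∞) := hf.min measurable_const
    have hv : Measurable fun x => min (h x) (T : ℝ≥0∞) := hh.min measurable_const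
    refine le_inv_mul_of_le_add_mul ?_ hq ?_
    · refine ne_top_of_le_ne_top (ENNReal.rpow_ne_top_of_nonneg hp.le
        (ENNReal.coe_ne_top (r := T))) ?_
      calc ∫⁻ x, min (f x) T ^ p ∂ν ≤ ∫⁻ _, (T : ℝ≥0∞) ^ p ∂ν := by
            gcongr; exact min_le_right _ _
        _ = (T : ℝ≥0∞) ^ p := by simp
    have e0 := lintegral_rpow_eq_lintegral_measure_lt (ν := ν) hp hu fun x => hmT _
    -- The constant function `a` accounts for the low levels `t < a` and contributes `a ^ p`.
    have e1 := lintegral_rpow_eq_lintegral_measure_lt (ν := ν) hp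
      (measurable_const (a := (a : ℝ≥0∞))) fun x => ENNReal.coe_ne_top
    have e2 := lintegral_rpow_eq_lintegral_measure_lt (ν := ν) hp (hv.const_mul (β : ℝ≥0∞))
      fun x => ENNReal.mul_ne_top ENNReal.coe_ne_top (hmT _)
    have e3 := lintegral_rpow_eq_lintegral_measure_lt (ν := ν) hp (hu.const_mul (K : ℝ≥0∞))
      fun x => ENNReal.mul_ne_top ENNReal.coe_ne_top (hmT _)
    have hanti : ∀ w : Ω → ℝ≥0∞, Measurable fun t : ℝ =>
        ν {x | ENNReal.ofReal t < w x} * ENNReal.ofReal (t ^ (p - 1)) := fun w => by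
      refine Measurable.mul (Antitone.measurable fun s t hst => measure_mono fun x hx => ?_)
        (by fun_prop)
      exact (ENNReal.ofReal_le_ofReal hst).trans_lt hx
    have hsum : ∫⁻ x, min (f x) T ^ p ∂ν ≤ ∫⁻ _, (a : ℝ≥0∞) ^ p ∂ν +
        ∫⁻ x, (β * min (h x) T) ^ p ∂ν + q * ∫⁻ x, (K * min (f x) T) ^ p ∂ν := by
      rw [e0, e1, e2, e3, mul_left_comm (q : ℝ≥0∞), ← mul_add, ← mul_add,
        ← lintegral_add_left (hanti _), ← lintegral_const_mul (q : ℝ≥0∞) (hanti _),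
        ← lintegral_add_right _ ((hanti _).const_mul (q : ℝ≥0∞))]
      gcongr with t
      rw [← mul_assoc, ← add_mul, ← add_mul]
      gcongr
      exact measure_lt_min_le hβ hK hyp T t.toNNReal
    refine hsum.trans ?_
    simp only [ENNReal.mul_rpow_of_nonneg _ _ hp.le]
    rw [lintegral_const, measure_univ, mul_one, lintegral_const_mul _ (hv.pow_const p),
      lintegral_const_mul _ (hu.pow_const p), ← mul_assoc]
    gcongr with x
    exact min_le_left _ _
  have hmono : ∀ x, Monotone fun n : ℕ => min (f x) ((n : ℝ≥0) : ℝ≥0∞) ^ p :=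
    fun x m n hmn => by
      dsimp only
      gcongr
  have hsup : ∀ x, f x ^ p ≤ ⨆ n : ℕ, min (f x) ((n : ℝ≥0) : ℝ≥0∞) ^ p := by
    intro x
    have h1 : Filter.Tendsto (fun n : ℕ => min (f x) ((n : ℝ≥0) : ℝ≥0∞) ^ p) Filter.atTop
        (nhds (min (f x) ∞ ^ p)) := by
      refine ((ENNReal.continuous_rpow_const).tendsto _).comp ?_
      refine tendsto_const_nhds.min ?_
      simpa using ENNReal.tendsto_nat_nhds_top
    rw [min_eq_left le_top] at h1
    exact (tendsto_nhds_unique h1 (tendsto_atTop_iSup (hmono x))).le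
  calc ∫⁻ x, f x ^ p ∂ν ≤ ∫⁻ x, ⨆ n : ℕ, min (f x) ((n : ℝ≥0) : ℝ≥0∞) ^ p ∂ν :=
        lintegral_mono hsup
    _ = ⨆ n : ℕ, ∫⁻ x, min (f x) ((n : ℝ≥0) : ℝ≥0∞) ^ p ∂ν :=
        lintegral_iSup (fun n => (hf.min measurable_const).pow_const p)
          fun m n hmn x => hmono x hmn
    _ ≤ _ := iSup_le fun n => htrunc n

theorem eLpNorm_ofReal_eq (hp : 0 < p) (f : Ω → ℝ≥0∞) :
    eLpNorm f (ENNReal.ofReal p) ν = (∫⁻ x, f x ^ p ∂ν) ^ (1 / p) := by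
  rw [eLpNorm_eq_lintegral_rpow_enorm_toReal (by simpa using hp) ENNReal.ofReal_ne_top,
    ENNReal.toReal_ofReal hp.le]
  simp only [enorm_eq_self]

theorem eLpNorm_le_of_goodLambda [IsProbabilityMeasure ν] (hp : 1 ≤ p)
    {f h : Ω → ℝ≥0∞} (hf : Measurable f) (hh : Measurable h) {a β q K : ℝ≥0} (hβ : 1 ≤ β)
    (hK : 1 ≤ K) (hq : (q : ℝ≥0∞) * (K : ℝ≥0∞) ^ p < 1)
    (hyp : ∀ t : ℝ≥0, a ≤ t → ν {x | (t : ℝ≥0∞) < f x} ≤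
      ν {x | (t : ℝ≥0∞) < β * h x} + q * ν {x | (t : ℝ≥0∞) < K * f x}) :
    eLpNorm f (ENNReal.ofReal p) ν ≤ ((1 - (q : ℝ≥0∞) * (K : ℝ≥0∞) ^ p)⁻¹) ^ (1 / p) *
      (a + β * eLpNorm h (ENNReal.ofReal p) ν) := by
  have hp0 : 0 < p := by linarith
  have hp' : 0 ≤ 1 / p := by positivity
  have hp1 : 1 / p ≤ 1 := by rw [div_le_one hp0]; exact hp
  have hinv : ∀ y : ℝ≥0∞, (y ^ p) ^ (1 / p) = y := fun y => by
    rw [← ENNReal.rpow_mul, mul_one_div_cancel hp0.ne', ENNReal.rpow_one]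
  rw [eLpNorm_ofReal_eq hp0, eLpNorm_ofReal_eq hp0]
  refine (ENNReal.rpow_le_rpow (lintegral_rpow_le_of_goodLambda hp0 hf hh hβ hK hq hyp)
    hp').trans ?_
  rw [ENNReal.mul_rpow_of_nonneg _ _ hp']
  gcongr
  refine (ENNReal.rpow_add_le_add_rpow _ _ hp' hp1).trans_eq ?_
  rw [ENNReal.mul_rpow_of_nonneg _ _ hp', hinv, hinv]

end Distribution

/-! ### Choice of parameters and norm estimates -/

section NormEstimates

/-- As `2m - Θ ≥ Θ`, the target is at most `M(δ + γ)/Θ · (2m)^p`. The bound on `p` says that this is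
below 1 for `γ = 0`; a small `γ` uses up at most half of the gap `s`. The case `δ = 0` is separate
because `Real.log (1 / 0)` is `0`, not infinity. -/
theorem exists_gamma {M Θ δ m p : ℝ} (hM : 1 ≤ M) (hΘ : 1 ≤ Θ) (hδ : 0 ≤ δ) (hm : Θ ≤ m)
    (hp : δ = 0 ∨ p < Real.log (1 / (M * δ * Θ⁻¹)) / Real.log (2 * m)) :
    ∃ γ : ℝ, 0 < γ ∧ γ < 1 ∧ M * ((δ + γ) / (2 * m - Θ)) * (2 * m) ^ p < 1 := by
  have hK : 0 < (2 * m) ^ p := Real.rpow_pos_of_pos (by linarith) p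
  have hs : M * δ / Θ * (2 * m) ^ p < 1 := by
    rcases hδ.eq_or_lt with h0 | h0
    · simp [← h0]
    have h := hp.resolve_left h0.ne'
    have hlog : 0 < Real.log (2 * m) := Real.log_pos (by linarith)
    have hpos : 0 < M * δ * Θ⁻¹ := by positivity
    rw [lt_div_iff₀ hlog, ← Real.log_rpow (by linarith),
      Real.log_lt_log_iff hK (by positivity), lt_div_iff₀ hpos] at h
    rw [div_eq_mul_inv, mul_comm]
    exact h
  set s := 1 - M * δ / Θ * (2 * m) ^ p with hsdef
  have hs0 : 0 < s := by linarith
  refine ⟨min (1 / 2) (s * Θ / (2 * M * (2 * m) ^ p)), by positivity,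
    (min_le_left _ _).trans_lt (by norm_num), ?_⟩
  set γ := min (1 / 2) (s * Θ / (2 * M * (2 * m) ^ p)) with hγdef
  have hγ0 : 0 < γ := by positivity
  have h1 : γ * (2 * M * (2 * m) ^ p) ≤ s * Θ :=
    (le_div_iff₀ (by positivity)).1 (min_le_right _ _)
  calc M * ((δ + γ) / (2 * m - Θ)) * (2 * m) ^ p ≤ M * ((δ + γ) / Θ) * (2 * m) ^ p := by
        gcongr
        linarith
    _ = M * δ / Θ * (2 * m) ^ p + γ * (2 * M * (2 * m) ^ p) / Θ / 2 := by ring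
    _ ≤ M * δ / Θ * (2 * m) ^ p + s * Θ / Θ / 2 := by gcongr
    _ < 1 := by rw [mul_div_cancel_right₀ _ (by positivity)]; linarith

theorem cond_le_smul_cond {X : Type*} [MeasurableSpace X] {μ : Measure X} {B W : Set X}
    (hBW : B ⊆ W) (h0 : μ W ≠ 0) (h1 : μ W ≠ ∞) :
    μ[|B] ≤ (μ W / μ B) • μ[|W] := by
  rw [ProbabilityTheory.cond, ProbabilityTheory.cond, smul_smul, ENNReal.div_eq_inv_mul, mul_assoc,
    ENNReal.mul_inv_cancel h0 h1, mul_one]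
  exact Measure.le_iff'.2 fun s => by
    simp only [Measure.smul_apply, smul_eq_mul]
    gcongr

variable {X : Type*} [MetricSpace X] [MeasurableSpace X] [BorelSpace X] {μ : Measure X}
  {c D : ℝ} {x₀ : X} {r₀ η τ Θ δ : ℝ} {F : X → ℝ≥0∞}
  {G H : X × ℝ → X → ℝ≥0∞} {g : X × ℝ → ℝ≥0}

/-- The good-lambda inequality for the normalized measure. -/
theorem Admissible.cond_maximal_le (hμ : IsDoubling μ)
    (hcD : HasDoublingConstants μ c D) (hη : 0 < η) (hr₀ : 0 < r₀) (hτ : 1 ≤ τ) (hΘ : 1 ≤ Θ)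
    (hδ : 0 ≤ δ) (hA : Admissible μ x₀ r₀ η τ Θ δ F G H g) {lam₀ K γ M : ℝ}
    (hlam₀ : max 1 (c * ((2 + η) * (τ * 13) / η) ^ D) ≤ lam₀)
    (hM : c * 5 ^ D * (c * 13 ^ D) ≤ M) (hK : Θ < K) (hγ : 0 < γ) (t : ℝ≥0)
    (ht : K * lam₀ * (⨍⁻ x in ball x₀ ((1 + η) * r₀), F x ∂μ).toReal ≤ t) :
    (μ[|ball x₀ ((1 + η) * r₀)])
        {x | (t : ℝ≥0∞) < maximal μ (basis x₀ r₀ η) F x} ≤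
      (μ[|ball x₀ ((1 + η) * r₀)])
        {x | (t : ℝ≥0∞) < (K / γ).toNNReal * gStar (basis x₀ r₀ η) g x} +
      (M * ((δ + γ) / (K - Θ))).toNNReal * (μ[|ball x₀ ((1 + η) * r₀)])
        {x | (t : ℝ≥0∞) < K.toNNReal * maximal μ (basis x₀ r₀ η) F x} := by
  have hK0 : 0 < K := by linarith
  have hgl := hA.measure_goodLambda_le_of_le hμ hcD hη hr₀ hτ hΘ hδ (lam := t / K) hlam₀
    (by rw [le_div_iff₀ hK0]; linarith) hK hγ
  rw [mul_div_cancel₀ _ hK0.ne', ENNReal.ofReal_coe_nnreal] at hgl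
  have hdiv : ∀ k : ℝ, 0 < k → ∀ y : ℝ≥0∞,
      (t : ℝ≥0∞) < k.toNNReal * y ↔ ENNReal.ofReal (t / k) < y := fun k hk y => by
    rw [lt_mul_iff_div_lt (by simpa using hk), ENNReal.ofReal, Real.toNNReal_div' hk.le,
      Real.toNNReal_coe]
  simp only [hdiv K hK0, hdiv (K / γ) (by positivity)]
  have hWm : MeasurableSet (ball x₀ ((1 + η) * r₀)) := isOpen_ball.measurableSet
  simp only [ProbabilityTheory.cond_apply hWm]
  rw [mul_left_comm, ← mul_add]
  gcongr
  -- Split according to whether `G*` exceeds `γ t / K`; the good-lambda inequality at level `t / K`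
  -- handles the second piece.
  have hsub : ball x₀ ((1 + η) * r₀) ∩ {x | (t : ℝ≥0∞) < maximal μ (basis x₀ r₀ η) F x} ⊆
      (ball x₀ ((1 + η) * r₀) ∩
        {x | ENNReal.ofReal (t / (K / γ)) < gStar (basis x₀ r₀ η) g x}) ∪
      {x ∈ ball x₀ ((1 + η) * r₀) | (t : ℝ≥0∞) < maximal μ (basis x₀ r₀ η) F x ∧
        gStar (basis x₀ r₀ η) g x ≤ ENNReal.ofReal (γ * (t / K))} := by
    rintro x ⟨hxW, hx⟩
    have he : (t : ℝ) / (K / γ) = γ * (t / K) := by field_simp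
    rcases lt_or_ge (ENNReal.ofReal (γ * (t / K))) (gStar (basis x₀ r₀ η) g x) with h | h
    · exact Or.inl ⟨hxW, by rw [mem_ofPred_eq, he]; exact h⟩
    · exact Or.inr ⟨hxW, hx, h⟩
  refine (measure_mono hsub).trans ((measure_union_le _ _).trans ?_)
  gcongr
  refine hgl.trans (mul_le_mul' (ENNReal.ofReal_le_ofReal ?_) le_rfl)
  have : 0 < K - Θ := by linarith
  gcongr

/-- Weak and strong norm estimates for the maximal function. -/
theorem exists_norm_maximal_le (hμ : IsDoubling μ) (hcD : HasDoublingConstants μ c D)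
    (hη : 0 < η) (hτ : 1 ≤ τ) (hΘ : 1 ≤ Θ) (hδ : 0 ≤ δ) {M m p : ℝ} (hM : 1 ≤ M)
    (hcM : c * 5 ^ D * (c * 13 ^ D) ≤ M) (hm : Θ ≤ m) (hp1 : 1 < p)
    (hp : δ = 0 ∨ p < Real.log (1 / (M * δ * Θ⁻¹)) / Real.log (2 * m)) :
    ∃ C : ℝ≥0, ∀ (x₀ : X) (r₀ : ℝ), 0 < r₀ →
      ∀ (F : X → ℝ≥0∞) (G H : X × ℝ → X → ℝ≥0∞) (g : X × ℝ → ℝ≥0),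
      Admissible μ x₀ r₀ η τ Θ δ F G H g →
        weakNorm μ p (ball x₀ ((1 + η) * r₀)) (maximal μ (basis x₀ r₀ η) F)
          ≤ C * (weakNorm μ p (ball x₀ ((1 + η) * r₀)) (gStar (basis x₀ r₀ η) g)
            + ⨍⁻ x in ball x₀ ((1 + η) * r₀), F x ∂μ) ∧
        strongNorm μ p (ball x₀ ((1 + η) * r₀)) (maximal μ (basis x₀ r₀ η) F)
          ≤ C * (strongNorm μ p (ball x₀ ((1 + η) * r₀)) (gStar (basis x₀ r₀ η) g)
            + ⨍⁻ x in ball x₀ ((1 + η) * r₀), F x ∂μ) := by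
  have hp0 : 0 < p := by linarith
  obtain ⟨γ, hγ0, hγ1, hγ⟩ := exists_gamma hM hΘ hδ hm hp
  set K := 2 * m with hKdef
  have hK1 : 1 ≤ K := by linarith
  have hKΘ : Θ < K := by linarith
  set lam₀ := max 1 (c * ((2 + η) * (τ * 13) / η) ^ D) with hlam₀
  have hlam₀1 : 1 ≤ lam₀ := le_max_left _ _
  have hq0 : 0 ≤ M * ((δ + γ) / (K - Θ)) := by
    have : 0 < K - Θ := by linarith
    positivity
  set q := (M * ((δ + γ) / (K - Θ))).toNNReal with hq
  set β := (K / γ).toNNReal with hβ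
  have hβ1 : 1 ≤ β := by
    rw [hβ, Real.one_le_toNNReal, le_div_iff₀ hγ0]
    linarith
  have hKn : 1 ≤ K.toNNReal := Real.one_le_toNNReal.2 hK1
  have hqs : (q : ℝ≥0∞) * (K.toNNReal : ℝ≥0∞) ^ p < 1 := by
    change ENNReal.ofReal _ * ENNReal.ofReal K ^ p < 1
    rw [ENNReal.ofReal_rpow_of_nonneg (by linarith) hp0.le, ← ENNReal.ofReal_mul hq0]
    exact ENNReal.ofReal_lt_one.2 hγ
  have hqw : (q : ℝ≥0∞) ^ (1 / p) * (K.toNNReal : ℝ≥0∞) < 1 := by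
    have h := ENNReal.rpow_lt_rpow hqs (show 0 < 1 / p by positivity)
    rwa [ENNReal.one_rpow, ENNReal.mul_rpow_of_nonneg _ _ (by positivity), ← ENNReal.rpow_mul,
      mul_one_div_cancel hp0.ne', ENNReal.rpow_one] at h
  have hinv : ∀ θ : ℝ≥0∞, θ < 1 → (1 - θ)⁻¹ ≠ ∞ := fun θ hθ =>
    ENNReal.inv_ne_top.2 (tsub_pos_of_lt hθ).ne'
  have hcomb : ∀ C C' κ W A : ℝ≥0∞, C ≤ C' →
      C * (κ * A + β * W) ≤ C' * (κ + β) * (W + A) := fun C C' κ W A h => by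
    rw [mul_assoc, add_mul]
    gcongr
    · exact le_add_self
    · exact le_self_add
  have hC₁ := ENNReal.coe_toNNReal (hinv _ hqw)
  have hC₂ := ENNReal.coe_toNNReal (ENNReal.rpow_ne_top_of_nonneg
    (show 0 ≤ 1 / p by positivity) (hinv _ hqs))
  set C₁ := ((1 - (q : ℝ≥0∞) ^ (1 / p) * (K.toNNReal : ℝ≥0∞))⁻¹).toNNReal
  set C₂ := (((1 - (q : ℝ≥0∞) * (K.toNNReal : ℝ≥0∞) ^ p)⁻¹) ^ (1 / p)).toNNReal
  -- One constant serves both norms and is fixed before the ball and the functions are introduced.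
  refine ⟨max C₁ C₂ * ((K * lam₀).toNNReal + β), fun x₀ r₀ hr₀ F G H g hA => ?_⟩
  have hpos := hμ.pos x₀ ((1 + η) * r₀) (by positivity)
  have : IsProbabilityMeasure (μ[|ball x₀ ((1 + η) * r₀)]) :=
    ProbabilityTheory.cond_isProbabilityMeasure_of_finite hpos.ne' (hμ.ne_top _ _)
  have hfin := hA.setLAverage_ne_top hμ hr₀ hη
  set A := ⨍⁻ x in ball x₀ ((1 + η) * r₀), F x ∂μ with hAdef
  have hyp : ∀ t : ℝ≥0, (K * lam₀ * A.toReal).toNNReal ≤ t → _ := fun t ht =>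
    hA.cond_maximal_le hμ hcD hη hr₀ hτ hΘ hδ le_rfl hcM hKΘ hγ0 t
      (Real.toNNReal_le_iff_le_coe.1 ht)
  have ha : ((K * lam₀ * A.toReal).toNNReal : ℝ≥0∞) = (K * lam₀).toNNReal * A := by
    rw [Real.toNNReal_mul (by positivity), ENNReal.coe_mul]
    congr 1
    exact ENNReal.ofReal_toReal hfin
  rw [ENNReal.coe_mul, ENNReal.coe_add]
  constructor
  · refine (weakLpNorm_le_of_goodLambda hp1.le hβ1 hKn hqw hyp).trans ?_
    rw [ha, ← hC₁]
    exact hcomb _ _ _ _ _ (ENNReal.coe_le_coe.2 (le_max_left _ _))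
  · refine (eLpNorm_le_of_goodLambda hp1.le (measurable_maximal _ _) (measurable_gStar _ _)
      hβ1 hKn hqs hyp).trans ?_
    rw [ha, ← hC₂]
    exact hcomb _ _ _ _ _ (ENNReal.coe_le_coe.2 (le_max_right _ _))

theorem ae_cond_le_maximal (hμ : IsDoubling μ) (hr₀ : 0 < r₀) (hη : 0 < η)
    (hA : Admissible μ x₀ r₀ η τ Θ δ F G H g) :
    ∀ᵐ x ∂(μ[|ball x₀ r₀]), F x ≤ maximal μ (basis x₀ r₀ η) F x :=
  Measure.ae_smul_measure (ae_le_maximal hμ hr₀ hη hA.integrable) _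

theorem Admissible.weakNorm_le (hμ : IsDoubling μ) (hr₀ : 0 < r₀) (hη : 0 < η) {p : ℝ}
    (hp : 0 < p) (hA : Admissible μ x₀ r₀ η τ Θ δ F G H g) :
    weakNorm μ p (ball x₀ r₀) F ≤
      (μ (ball x₀ ((1 + η) * r₀)) / μ (ball x₀ r₀)) ^ (1 / p) *
        weakNorm μ p (ball x₀ ((1 + η) * r₀)) (maximal μ (basis x₀ r₀ η) F) :=
  (weakLpNorm_mono_ae hp (ae_cond_le_maximal hμ hr₀ hη hA)).trans
    (weakLpNorm_le_of_measure_le hp (cond_le_smul_cond (ball_subset_ball (by nlinarith))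
      (hμ.pos _ _ (by positivity)).ne' (hμ.ne_top _ _)) _)

theorem Admissible.strongNorm_le (hμ : IsDoubling μ) (hr₀ : 0 < r₀) (hη : 0 < η) {p : ℝ}
    (hp : 0 < p) (hA : Admissible μ x₀ r₀ η τ Θ δ F G H g) :
    strongNorm μ p (ball x₀ r₀) F ≤
      (μ (ball x₀ ((1 + η) * r₀)) / μ (ball x₀ r₀)) ^ (1 / p) *
        strongNorm μ p (ball x₀ ((1 + η) * r₀)) (maximal μ (basis x₀ r₀ η) F) := by
  have hW := hμ.pos x₀ ((1 + η) * r₀) (by positivity)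
  have hp' : 0 ≤ 1 / p := by positivity
  rw [strongNorm, strongNorm, eLpNorm_ofReal_eq hp, eLpNorm_ofReal_eq hp,
    ← ENNReal.mul_rpow_of_nonneg _ _ hp']
  refine ENNReal.rpow_le_rpow ?_ hp'
  calc ∫⁻ x, F x ^ p ∂(μ[|ball x₀ r₀])
      ≤ ∫⁻ x, maximal μ (basis x₀ r₀ η) F x ^ p ∂(μ[|ball x₀ r₀]) := by
        refine lintegral_mono_ae ?_
        filter_upwards [ae_cond_le_maximal hμ hr₀ hη hA] with x hx
        exact ENNReal.rpow_le_rpow hx hp.le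
    _ ≤ _ := by
        refine (lintegral_mono' (cond_le_smul_cond (ball_subset_ball (by nlinarith))
          hW.ne' (hμ.ne_top _ _)) le_rfl).trans_eq ?_
        rw [lintegral_smul_measure, smul_eq_mul]

end NormEstimates

end GoodLambda

/-! ### The main theorem -/

theorem mainTheorem2 {X : Type*} [MetricSpace X] [MeasurableSpace X] [BorelSpace X]
    (μ : Measure X) (hμ : GoodLambda.IsDoubling μ)
    (cμ D : ℝ) (hD : 0 < D) (hcD : GoodLambda.HasDoublingConstants μ cμ D) :
    ∃ Cμ : ℝ, 1 ≤ Cμ ∧ ∀ η τ : ℝ, 0 < η → 1 ≤ τ →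
      -- the good-lambda inequality
      (∃ lam₀ : ℝ, 0 < lam₀ ∧
        ∀ (x₀ : X) (r₀ : ℝ), 0 < r₀ → ∀ Θ δ : ℝ, 1 ≤ Θ → 0 ≤ δ → δ < 1 / 2 →
        ∀ (F : X → ℝ≥0∞) (G H : X × ℝ → X → ℝ≥0∞) (g : X × ℝ → ℝ≥0),
        GoodLambda.Admissible μ x₀ r₀ η τ Θ δ F G H g →
        ∀ lam K γ : ℝ,
          lam₀ * (⨍⁻ x in ball x₀ ((1 + η) * r₀), F x ∂μ).toReal ≤ lam →
          max Θ (cμ * 3 ^ D) < K → 0 < γ → γ < 1 →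
          μ {x ∈ ball x₀ ((1 + η) * r₀) |
              ENNReal.ofReal (K * lam)
                < GoodLambda.maximal μ (GoodLambda.basis x₀ r₀ η) F x ∧
              GoodLambda.gStar (GoodLambda.basis x₀ r₀ η) g x ≤ ENNReal.ofReal (γ * lam)}
            ≤ ENNReal.ofReal (Cμ * ((δ + γ) / (K - Θ))) *
              μ {x ∈ ball x₀ ((1 + η) * r₀) |
                ENNReal.ofReal lam
                  < GoodLambda.maximal μ (GoodLambda.basis x₀ r₀ η) F x}) ∧
      -- the weak and strong norm estimates
      (∀ Θ δ p : ℝ, 1 ≤ Θ → 0 ≤ δ → δ < 1 / (2 * Cμ) * min 1 (Θ / (cμ * 3 ^ D)) →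
        1 < p →
        (δ = 0 ∨
          p < Real.log (1 / (Cμ * δ * Θ⁻¹)) / Real.log (2 * max Θ (cμ * 3 ^ D))) →
        ∃ C : ℝ≥0, ∀ (x₀ : X) (r₀ : ℝ), 0 < r₀ →
        ∀ (F : X → ℝ≥0∞) (G H : X × ℝ → X → ℝ≥0∞) (g : X × ℝ → ℝ≥0),
        GoodLambda.Admissible μ x₀ r₀ η τ Θ δ F G H g →
          (GoodLambda.weakNorm μ p (ball x₀ r₀) F
            ≤ C * GoodLambda.weakNorm μ p (ball x₀ ((1 + η) * r₀))
                (GoodLambda.maximal μ (GoodLambda.basis x₀ r₀ η) F)) ∧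
          (GoodLambda.weakNorm μ p (ball x₀ ((1 + η) * r₀))
              (GoodLambda.maximal μ (GoodLambda.basis x₀ r₀ η) F)
            ≤ C * (GoodLambda.weakNorm μ p (ball x₀ ((1 + η) * r₀))
                  (GoodLambda.gStar (GoodLambda.basis x₀ r₀ η) g)
                + ⨍⁻ x in ball x₀ ((1 + η) * r₀), F x ∂μ)) ∧
          (GoodLambda.strongNorm μ p (ball x₀ r₀) F
            ≤ (μ (ball x₀ ((1 + η) * r₀)) / μ (ball x₀ r₀)) ^ (1 / p) *
              GoodLambda.strongNorm μ p (ball x₀ ((1 + η) * r₀))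
                (GoodLambda.maximal μ (GoodLambda.basis x₀ r₀ η) F)) ∧
          (GoodLambda.strongNorm μ p (ball x₀ ((1 + η) * r₀))
              (GoodLambda.maximal μ (GoodLambda.basis x₀ r₀ η) F)
            ≤ C * (GoodLambda.strongNorm μ p (ball x₀ ((1 + η) * r₀))
                  (GoodLambda.gStar (GoodLambda.basis x₀ r₀ η) g)
                + ⨍⁻ x in ball x₀ ((1 + η) * r₀), F x ∂μ))) := by
  refine ⟨max 1 (cμ * 5 ^ D * (cμ * 13 ^ D)), le_max_left _ _, fun η τ hη hτ =>
    ⟨⟨max 1 (cμ * ((2 + η) * (τ * 13) / η) ^ D), by positivity, ?_⟩, ?_⟩⟩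
  · intro x₀ r₀ hr₀ Θ δ hΘ hδ _ F G H g hA lam K γ hlam hK hγ _
    have hK' : Θ < K := (le_max_left _ _).trans_lt hK
    refine (hA.measure_goodLambda_le_of_le hμ hcD hη hr₀ hτ hΘ hδ le_rfl hlam hK' hγ).trans
      (mul_le_mul' (ENNReal.ofReal_le_ofReal ?_) le_rfl)
    have : 0 < K - Θ := by linarith
    gcongr
    exact le_max_right _ _
  · intro Θ δ p hΘ hδ _ hp1 hp
    have hp0 : 0 < p := by linarith
    obtain ⟨C, hC⟩ := GoodLambda.exists_norm_maximal_le hμ hcD hη hτ hΘ hδ (le_max_left _ _)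
      (le_max_right _ _) (le_max_left _ _) hp1 hp
    -- The second entry bounds the ratio of the measures of the enlarged and the original ball,
    -- uniformly in the ball, for the first weak estimate.
    refine ⟨max C (ENNReal.ofReal (cμ * (1 + η) ^ D) ^ (1 / p)).toNNReal,
      fun x₀ r₀ hr₀ F G H g hA => ?_⟩
    obtain ⟨h1, h2⟩ := hC x₀ r₀ hr₀ F G H g hA
    have hle : (C : ℝ≥0∞) ≤
        (max C (ENNReal.ofReal (cμ * (1 + η) ^ D) ^ (1 / p)).toNNReal : ℝ≥0) :=
      ENNReal.coe_le_coe.2 (le_max_left _ _)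
    refine ⟨(hA.weakNorm_le hμ hr₀ hη hp0).trans (mul_le_mul' ?_ le_rfl),
      h1.trans (by gcongr), hA.strongNorm_le hμ hr₀ hη hp0, h2.trans (by gcongr)⟩
    have hp' : 0 ≤ 1 / p := by positivity
    refine le_trans ?_ (ENNReal.coe_le_coe.2 (le_max_right _ _))
    rw [ENNReal.coe_toNNReal (ENNReal.rpow_ne_top_of_nonneg hp' ENNReal.ofReal_ne_top)]
    refine ENNReal.rpow_le_rpow ?_ hp'
    rw [ENNReal.div_le_iff (hμ.pos _ _ hr₀).ne' (hμ.ne_top _ _)]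
    exact hcD.measure_mul_le hμ _ hr₀ (by linarith)
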